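/- **Theorem (Global Markov Property for a mixture of DAGs).** *Setting.* Let $X=(X_v)_{v\in V}$ be a finite random vector, let $X_v$ take values in a measurable space with a $\sigma$-finite reference measure $\mu_v$, and let $T$ be an auxiliary variable with density $f(t)$ with respect to a $\sigma$-finite measure $\nu$ and support $S=\{t: f(t)\neq 0\}$. For every $t\in S$ let $G^t$ be a DAG over $Z=X\cup\{T\}$ in which $T$ has no parents, and let $f(x_v\mid \mathrm{pa}_{G^t}(x_v),t)$ be probability densities in $x_v$ that depend only on $x_v$, on the values of the parents of $X_v$ among $X$ in $G^t$, and on $t$. Suppose that $X$ has density $$f(x)=\int f(t)\prod_{v\in V} f\big(x_v\mid \mathrm{pa}_{G^t}(x_v),t\big)\,d\nu(t)$$ with respect to $\bigotimes_v\mu_v$ (a sum over $t$ if $T$ is discrete). Let $X^\emptyset$ be the set of those $X_v$ whose set of parents among $X$ and whose conditional density $f(x_v\mid \mathrm{pa}_{G^t}(x_v),t)$ do not vary with $t\in S$; in every $G^t$, $t\in S$, the variable $T$ is a parent of exactly the variables in $X\setminus X^\emptyset$. The *mother graph* $M$ is the disjoint union of the distinct DAGs among the $G^t$, $t\in S$,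 which are called its *sub-DAGs*. *Definitions.* A triple $\langle Z_i,Z_j,Z_k\rangle$ can occur *as an m-collider* if $Z_i\to Z_j\leftarrow Z_k$ in some sub-DAG, or if all three are variables in $X$ with $Z_i\to Z_j\leftarrow T$ in one sub-DAG and $T\to Z_j\leftarrow Z_k$ in another sub-DAG. It can occur *as a non-m-collider* if $Z_i\to Z_j\to Z_k$, $Z_i\leftarrow Z_j\leftarrow Z_k$ or $Z_i\leftarrow Z_j\to Z_k$ in some sub-DAG. An *m-path* between $D$ and $E$ is a sequence of variables of $Z$ with first element in $D$ and last element in $E$, which is either a single pair of variables adjacent in some sub-DAG, or a sequence of length at least three in which every triple of consecutive variables occurs on the path either as an m-collider or as a non-m-collider; different triples may come from different sub-DAGs, and variables may recur. The sets $D,E\subseteq Z$ are *m-d-connected* given $F\subseteq Z$ if there is an m-path between them such that the middle variable of every triple that occurs on it as an m-collider is in $F$ and the middle variable of every triple that occurs on it as a non-m-collider is not in $F$; otherwise they are *m-d-separated* given $F$. *Claim.* Let $A,B,C\subseteq X$ be disjoint. If $A$ and $B$ are m-d-separated given $C$ in $M$, then $A$ is conditionally independent of $B$ given $C$. -/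

import Mathlib

open MeasureTheory ProbabilityTheory
open scoped ENNReal NNReal

/-! The variables are `V` (standing for `X₁, …, X_p`), and `Option V` is `Z = X ∪ {T}`: the
variable `X_v` is `some v` and the auxiliary variable `T` is `none`. -/

/-- A digraph is acyclic: no vertex can be reached from itself along a nonempty directed walk. -/
def Digraph.NoDirectedCycle {Z : Type*} (G : Digraph Z) : Prop :=
  ∀ z, ¬ Relation.TransGen G.Adj z z

/-- The parents among `X` of the variable `X_v` in a digraph over `X ∪ {T}`. -/
def Digraph.xParents {V : Type*} (G : Digraph (Option V)) (v : V) : Set V :=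
  {u | G.Adj (some u) (some v)}

/-- The set `X^∅` of the variables whose parent set (among `X`) and whose conditional density given
the parents do not vary over the support `S` of the density of `T`. -/
def timeInvariantVars {V 𝒯 α : Type*} (S : Set 𝒯) (dag : 𝒯 → Digraph (Option V))
    (kernel : V → 𝒯 → α) : Set V :=
  {v | ∀ s ∈ S, ∀ t ∈ S,
    (dag s).xParents v = (dag t).xParents v ∧ kernel v s = kernel v t}

/-- A mixture of DAGs. The auxiliary variable `T` has density `timeDensity` with respect to `ν`.
At each `t` in the support, the conditional density of `X` given `T = t` (with respect to the
product of the measures `μ v`) is the product over `v` of the conditional densities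
`f(X_v | Pa_{G^t}(X_v), T = t)`, denoted by `kernel v t`, where `G^t = dag t` is a DAG over
`X ∪ {T}`. -/
structure MixtureOfDAGs (V : Type*) [Fintype V] [DecidableEq V] (𝓧 : V → Type*)
    [∀ v, MeasurableSpace (𝓧 v)] (μ : ∀ v, Measure (𝓧 v))
    (𝒯 : Type*) [MeasurableSpace 𝒯] (ν : Measure 𝒯) where
  /-- The density `f(T)`. -/
  timeDensity : 𝒯 → ℝ≥0
  measurable_timeDensity : Measurable timeDensity
  lintegral_timeDensity : ∫⁻ t, (timeDensity t : ℝ≥0∞) ∂ν = 1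
  /-- The graph `G^t`. -/
  dag : 𝒯 → Digraph (Option V)
  measurableSet_dag : ∀ G, MeasurableSet {t | dag t = G}
  /-- The conditional density `f(x_v | Pa(x_v), T = t)`, as a function of `t` and of `x`. -/
  kernel : V → 𝒯 → (∀ u, 𝓧 u) → ℝ≥0
  measurable_kernel : ∀ v, Measurable (Function.uncurry (kernel v))
  acyclic : ∀ t, timeDensity t ≠ 0 → (dag t).NoDirectedCycle
  /-- `T` has no parents. -/
  time_root : ∀ t, timeDensity t ≠ 0 → ∀ z, ¬ (dag t).Adj z none
  /-- `T` is a parent of exactly the variables outside `X^∅`. -/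
  time_parent : ∀ t, timeDensity t ≠ 0 → ∀ v,
    (dag t).Adj none (some v) ↔
      v ∉ timeInvariantVars {s | timeDensity s ≠ 0} dag kernel
  /-- `kernel v t` is a function of `x_v` and of the parents of `X_v` in `G^t` only. -/
  kernel_dependsOn : ∀ t, timeDensity t ≠ 0 → ∀ v,
    DependsOn (kernel v t) (insert v ((dag t).xParents v))
  /-- `kernel v t` is a probability density in `x_v` for all values of the parents. -/
  lintegral_kernel : ∀ t, timeDensity t ≠ 0 → ∀ v x,
    ∫⁻ y, (kernel v t (Function.update x v y) : ℝ≥0∞) ∂(μ v) = 1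

namespace MixtureOfDAGs

variable {V : Type*} [Fintype V] [DecidableEq V] {𝓧 : V → Type*}
  [∀ v, MeasurableSpace (𝓧 v)] {μ : ∀ v, Measure (𝓧 v)}
  {𝒯 : Type*} [MeasurableSpace 𝒯] {ν : Measure 𝒯}

/-- The mixture density `f(x) = ∫ f(t) ∏_v f(x_v | Pa_{G^t}(x_v), t) dν(t)`. -/
noncomputable def density (D : MixtureOfDAGs V 𝓧 μ 𝒯 ν) (x : ∀ v, 𝓧 v) : ℝ≥0∞ :=
  ∫⁻ t, ((D.timeDensity t * ∏ v, D.kernel v t x : ℝ≥0) : ℝ≥0∞) ∂ν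

/-- The set of the distinct DAGs `G^t`, `t` in the support of `f(T)`. -/
def subDAGs (D : MixtureOfDAGs V 𝓧 μ 𝒯 ν) : Set (Digraph (Option V)) :=
  D.dag '' {t | D.timeDensity t ≠ 0}

end MixtureOfDAGs

/-- The mother graph of a set of digraphs over `Z`: the digraphs are plotted next to each other, the
vertex `(G, z)` being the copy of the variable `z` in the sub-DAG `G`. -/
def motherGraph {Z : Type*} (𝒢 : Set (Digraph Z)) : Digraph (𝒢 × Z) where
  Adj p q := p.1 = q.1 ∧ (p.1 : Digraph Z).Adj p.2 q.2

section MixturePaths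

variable {ι V : Type*} (M : Digraph (ι × Option V))

/-- `x` and `y` are adjacent in the sub-DAG `i` (in either direction). -/
def AdjacentIn (i : ι) (x y : Option V) : Prop :=
  M.Adj (i, x) (i, y) ∨ M.Adj (i, y) (i, x)

/-- `x → y ← z` in the sub-DAG `i`. -/
def ColliderIn (i : ι) (x y z : Option V) : Prop :=
  M.Adj (i, x) (i, y) ∧ M.Adj (i, z) (i, y)

/-- `x → y → z`, `x ← y ← z` or `x ← y → z` in the sub-DAG `i`. -/
def NonColliderIn (i : ι) (x y z : Option V) : Prop :=
  (M.Adj (i, x) (i, y) ∧ M.Adj (i, y) (i, z)) ∨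
  (M.Adj (i, y) (i, x) ∧ M.Adj (i, z) (i, y)) ∨
  (M.Adj (i, y) (i, x) ∧ M.Adj (i, y) (i, z))

/-- The triple `⟨x, y, z⟩` forms an m-collider: `x → y ← z` in some sub-DAG, or
`X_i → X_j ← T` in one sub-DAG and `T → X_j ← X_k` in another one, with `x = X_i`, `y = X_j`,
`z = X_k`. -/
def FormsMCollider (x y z : Option V) : Prop :=
  (∃ i, ColliderIn M i x y z) ∨
  ∃ u v w : V, x = some u ∧ y = some v ∧ z = some w ∧
    ∃ i j, i ≠ j ∧ ColliderIn M i (some u) (some v) none ∧ ColliderIn M j none (some v) (some w)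

/-- The triple `⟨x, y, z⟩` forms a non-m-collider: it is a path in some sub-DAG that does not
collide at `y`. -/
def FormsNonMCollider (x y z : Option V) : Prop :=
  ∃ i, NonColliderIn M i x y z

/-- An m-path with first vertex `x`, second vertex `y` and last vertex `w`, given as its sequence of
triples. Each triple is realized on the path either as an m-collider or as a non-m-collider.
Vertices may recur, as on a walk; a path that consists of a single edge has no triples. -/
inductive MPath : Option V → Option V → Option V → Type _
  | edge (x y : Option V) (h : ∃ i, AdjacentIn M i x y) : MPath x y y
  | mCollider (x y z w : Option V) (h : FormsMCollider M x y z) (π : MPath y z w) : MPath x y w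
  | nonMCollider (x y z w : Option V) (h : FormsNonMCollider M x y z) (π : MPath y z w) :
      MPath x y w

variable {M} in
/-- The variables that occur as m-colliders on an m-path. -/
def MPath.mColliders {x y w : Option V} : MPath M x y w → Set (Option V)
  | .edge _ _ _ => ∅
  | .mCollider _ y _ _ _ π => insert y π.mColliders
  | .nonMCollider _ _ _ _ _ π => π.mColliders

variable {M} in
/-- The variables that occur as non-m-colliders on an m-path. -/
def MPath.nonMColliders {x y w : Option V} : MPath M x y w → Set (Option V)
  | .edge _ _ _ => ∅
  | .mCollider _ _ _ _ _ π => π.nonMColliders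
  | .nonMCollider _ y _ _ _ π => insert y π.nonMColliders

/-- `D` and `E` are m-d-connected given `F`: some m-path between them has all of its m-colliders in
`F` and none of its non-m-colliders in `F`. -/
def MDConnected (D E F : Set (Option V)) : Prop :=
  ∃ x ∈ D, ∃ w ∈ E, ∃ y, ∃ π : MPath M x y w,
    (∀ z ∈ π.mColliders, z ∈ F) ∧ ∀ z ∈ π.nonMColliders, z ∉ F

/-- `D` and `E` are m-d-separated given `F`. -/
def MDSeparated (D E F : Set (Option V)) : Prop :=
  ¬ MDConnected M D E F

end MixturePaths

/-- The random subvector `(X_v)_{v ∈ A}`. -/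
def subvector {Ω V : Type*} {𝓧 : V → Type*} (X : ∀ v, Ω → 𝓧 v) (A : Set V) :
    Ω → ∀ a : A, 𝓧 a :=
  fun ω a => X a ω

theorem measurable_subvector {Ω V : Type*} [MeasurableSpace Ω] {𝓧 : V → Type*}
    [∀ v, MeasurableSpace (𝓧 v)] {X : ∀ v, Ω → 𝓧 v} (hX : ∀ v, Measurable (X v)) (A : Set V) :
    Measurable (subvector X A) :=
  measurable_pi_lambda _ fun a => hX a

/-! Given `T = t`, the density is a product along a DAG. Take its edges among `X` and form the moral
graph of the ancestral set of `A ∪ B ∪ C`. An edge of this graph avoiding `C` transports active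
m-paths ending in `B` (`ReachesByTail.of_family`), so separation puts `A` outside the component of
`B` once `C` is deleted. Integrating over the variables outside `C` then splits the density into a
factor carrying `A` and a factor carrying `B` (`lmarginal_compl_mul_mul_prod`).

A mixture of products need not be a product, so one of the two factors must be free of `t`. The
children of `T` are the same in every sub-DAG, so whether an active m-path leads out of `T` to `B`
does not depend on the sub-DAG (`MixtureOfDAGs.reachesByTail_none_congr`). If one exists, `T` has no
child in the families that meet the component of `A`: otherwise an active m-path from `A` would
continue through `T`, possibly into another sub-DAG, and reach `B`. If none exists, the same holds
for the component of `B`. Kernels and parents of non-children of `T` do not vary with `t`, so the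
corresponding factor is constant (`MixtureOfDAGs.exists_lmarginal_prod_ekernel_factorization`), and
averaging the other factor over `t` keeps the product form.

The product form is expressed with test functions, as an identity of marginals
(`MixtureOfDAGs.lmarginal_density_mul_eq`). Applied to indicators, it becomes the product rule for
conditional probabilities, which are quotients of marginals. -/

section Marginals

/-! ### Marginals of products of kernels along a DAG. -/

variable {V : Type*} {𝓧 : V → Type*}

theorem DependsOn.mul_fun {f g : (∀ v, 𝓧 v) → ℝ≥0∞} {s : Set V} (hf : DependsOn f s)
    (hg : DependsOn g s) : DependsOn (f * g) s := fun x y h => by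
  simp only [Pi.mul_apply, hf h, hg h]

theorem dependsOn_finset_prod {k : V → (∀ v, 𝓧 v) → ℝ≥0∞} {F : Finset V} {s : Set V}
    (h : ∀ v ∈ F, DependsOn (k v) s) : DependsOn (∏ v ∈ F, k v) s := fun x y hxy => by
  simp only [Finset.prod_apply]
  exact Finset.prod_congr rfl fun v hv => h v hv hxy

theorem exists_sink_of_acyclic {r : V → V → Prop} (hr : ∀ v, ¬ Relation.TransGen r v v)
    {s : Finset V} (hs : s.Nonempty) : ∃ v ∈ s, ∀ u ∈ s, ¬ r v u := by
  by_contra! h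
  let r' : s → s → Prop := fun a b => Relation.TransGen r b a
  have : IsTrans s r' := ⟨fun a b c hab hbc => hbc.trans hab⟩
  have : Std.Irrefl r' := ⟨fun a => hr a⟩
  have wf : WellFounded r' := Finite.wellFounded_of_trans_of_irrefl r'
  obtain ⟨v0, hv0⟩ := hs
  obtain ⟨m, -, hm⟩ := wf.has_min Set.univ ⟨⟨v0, hv0⟩, trivial⟩
  obtain ⟨u, hu, hmu⟩ := h m m.2
  exact hm ⟨u, hu⟩ trivial (Relation.TransGen.single hmu)

variable [DecidableEq V] [∀ v, MeasurableSpace (𝓧 v)] {μ : ∀ v, Measure (𝓧 v)}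

theorem DependsOn.lmarginal {f : (∀ v, 𝓧 v) → ℝ≥0∞} {t : Set V} (hf : DependsOn f t)
    (s : Finset V) : DependsOn (lmarginal μ s f) (t \ s) := fun x y h => by
  refine lintegral_congr fun z => hf fun i hi => ?_
  by_cases his : i ∈ s
  · simp [Function.updateFinset, his]
  · simpa [Function.updateFinset, his] using h i ⟨hi, his⟩

theorem lmarginal_mul_left {f g : (∀ v, 𝓧 v) → ℝ≥0∞} {s : Finset V}
    (hf : DependsOn f (s : Set V)ᶜ) (hg : Measurable g) :
    lmarginal μ s (f * g) = f * lmarginal μ s g := by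
  ext x
  rw [Pi.mul_apply]
  unfold MeasureTheory.lmarginal
  rw [← lintegral_const_mul (f x) (f := fun z => g (Function.updateFinset x s z))
    (hg.comp measurable_updateFinset)]
  refine lintegral_congr fun z => ?_
  rw [Pi.mul_apply]
  congr 1
  refine hf fun i hi => ?_
  have : i ∉ s := hi
  simp [Function.updateFinset, this]

theorem lmarginal_mul_right {f g : (∀ v, 𝓧 v) → ℝ≥0∞} {s : Finset V}
    (hf : DependsOn f (s : Set V)ᶜ) (hg : Measurable g) :
    lmarginal μ s (g * f) = lmarginal μ s g * f := by
  rw [mul_comm, lmarginal_mul_left hf hg, mul_comm]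

variable [∀ v, SigmaFinite (μ v)]

/-- A product of conditional densities along a DAG integrates to one. -/
theorem lmarginal_prod_kernel_eq_one {r : V → V → Prop} (hr : ∀ v, ¬ Relation.TransGen r v v)
    {k : V → (∀ v, 𝓧 v) → ℝ≥0∞} (hk : ∀ v, Measurable (k v))
    (hdep : ∀ v, DependsOn (k v) (insert v {u | r u v}))
    (hint : ∀ v x, ∫⁻ y, k v (Function.update x v y) ∂(μ v) = 1) (s : Finset V) :
    lmarginal μ s (∏ v ∈ s, k v) = 1 := by
  induction s using Finset.strongInduction with
  | H s ih =>
    rcases s.eq_empty_or_nonempty with rfl | hs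
    · simp
    -- The coordinate of a sink occurs in no other factor of `s`, so it can be integrated out first.
    obtain ⟨v, hv, hsink⟩ := exists_sink_of_acyclic hr hs
    have hmeas : Measurable (∏ u ∈ s.erase v, k u) := by
      rw [Finset.prod_fn]
      exact Finset.measurable_prod _ fun u _ => hk u
    have hdep' : DependsOn (∏ u ∈ s.erase v, k u) (({v} : Finset V) : Set V)ᶜ := by
      refine dependsOn_finset_prod fun u hu => (hdep u).mono ?_
      rintro w (rfl | hw)
      · simpa using (Finset.mem_erase.1 hu).1
      · rw [Set.mem_compl_iff, Finset.mem_coe, Finset.mem_singleton]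
        rintro rfl
        exact hsink u (Finset.mem_of_mem_erase hu) hw
    have hd : Disjoint (s.erase v) {v} := by simp
    have hu : s = s.erase v ∪ {v} := by
      rw [Finset.union_comm, ← Finset.insert_eq, Finset.insert_erase hv]
    rw [← Finset.prod_erase_mul s k hv]
    have hun := lmarginal_union μ _ (hmeas.mul (hk v)) hd
    rw [← hu] at hun
    rw [hun]
    have : lmarginal μ {v} ((∏ u ∈ s.erase v, k u) * k v) = ∏ u ∈ s.erase v, k u := by
      rw [lmarginal_mul_left hdep' (hk v), lmarginal_singleton]
      ext x
      simp [hint]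
    rw [this]
    exact ih _ (Finset.erase_ssubset hv)

open Classical in
/-- Let `W` be closed under parents and let `H ⊆ W \ C` be such that every factor of `W` that
involves `H` involves `H ∪ C` only. The integral of the product of all factors over the variables
outside `C` splits into a part over `W \ (H ∪ C)` and a part over `H`. -/
theorem lmarginal_compl_mul_mul_prod [Fintype V] {r : V → V → Prop}
    (hr : ∀ v, ¬ Relation.TransGen r v v)
    {k : V → (∀ v, 𝓧 v) → ℝ≥0∞} (hk : ∀ v, Measurable (k v))
    (hdep : ∀ v, DependsOn (k v) (insert v {u | r u v}))
    (hint : ∀ v x, ∫⁻ y, k v (Function.update x v y) ∂(μ v) = 1)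
    {C W H : Set V} (hCW : C ⊆ W) (hW : ∀ u v, r u v → v ∈ W → u ∈ W)
    (hHW : H ⊆ W) (hHC : Disjoint H C) {K : Set V}
    (hK : ∀ w, w ∈ K ↔ w ∈ W ∧ ∃ u ∈ H, u = w ∨ r u w)
    (hKH : ∀ w ∈ K, insert w {u | r u w} ⊆ H ∪ C)
    {φ ψ : (∀ v, 𝓧 v) → ℝ≥0∞} (hφ : Measurable φ) (hψ : Measurable ψ)
    (hφH : DependsOn φ (W \ H)) (hψH : DependsOn ψ H) :
    lmarginal μ (Finset.univ.filter (· ∉ C)) (φ * ψ * ∏ v, k v) =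
      lmarginal μ (Finset.univ.filter fun v => v ∈ W ∧ v ∉ H ∧ v ∉ C)
          (φ * ∏ v with v ∈ W ∧ v ∉ K, k v) *
        lmarginal μ (Finset.univ.filter (· ∈ H)) (ψ * ∏ v with v ∈ K, k v) := by
  have hKW : K ⊆ W := fun w hw => ((hK w).1 hw).1
  have hprod : ∀ F : Finset V, Measurable (∏ v ∈ F, k v) := fun F => by
    rw [Finset.prod_fn]
    exact Finset.measurable_prod _ fun v _ => hk v
  set F₁ : Finset V := Finset.univ.filter fun v => v ∈ W ∧ v ∉ H ∧ v ∉ C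
  set F₂ : Finset V := Finset.univ.filter (· ∈ H)
  set F₃ : Finset V := Finset.univ.filter (· ∉ W)
  set a := φ * ∏ v with v ∈ W ∧ v ∉ K, k v with ha
  set b := ψ * ∏ v with v ∈ K, k v with hb
  have ham : Measurable a := hφ.mul (hprod _)
  have hbm : Measurable b := hψ.mul (hprod _)
  have ha_dep : DependsOn a (W \ H) := by
    refine hφH.mul_fun (dependsOn_finset_prod fun v hv => (hdep v).mono ?_)
    obtain ⟨hvW, hvK⟩ := (Finset.mem_filter.1 hv).2
    rintro u (rfl | hu)
    · exact ⟨hvW, fun huH => hvK ((hK _).2 ⟨hvW, _, huH, Or.inl rfl⟩)⟩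
    · exact ⟨hW u v hu hvW, fun huH => hvK ((hK _).2 ⟨hvW, u, huH, Or.inr hu⟩)⟩
  have hb_dep : DependsOn b (H ∪ C) :=
    (hψH.mono Set.subset_union_left).mul_fun (dependsOn_finset_prod fun v hv =>
      (hdep v).mono (hKH v (Finset.mem_filter.1 hv).2))
  have hsplit : (Finset.univ.filter (· ∉ C)) = (F₁ ∪ F₂) ∪ F₃ := by
    ext v
    simp only [F₁, F₂, F₃, Finset.mem_filter, Finset.mem_univ, true_and, Finset.mem_union]
    have h1 := @hCW v
    have h2 : v ∈ H → v ∉ C := fun h h' => Set.disjoint_left.1 hHC h h'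
    tauto
  have h12 : Disjoint F₁ F₂ := by
    rw [Finset.disjoint_left]
    simp only [F₁, F₂, Finset.mem_filter, Finset.mem_univ, true_and]
    tauto
  have h123 : Disjoint (F₁ ∪ F₂) F₃ := by
    rw [Finset.disjoint_left]
    simp only [F₁, F₂, F₃, Finset.mem_filter, Finset.mem_univ, true_and, Finset.mem_union]
    intro v hv
    have := @hHW v
    tauto
  -- The kernels fall into three groups: those in `K` involve only `H ∪ C`, those in `W \ K` avoid
  -- `H`, and those outside `W` integrate to one because `a * b` involves only `W`.
  have hfact : φ * ψ * ∏ v, k v = (a * b) * ∏ v ∈ F₃, k v := by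
    have e1 : ∏ v, k v = (∏ v with v ∈ W, k v) * ∏ v ∈ F₃, k v :=
      (Finset.prod_filter_mul_prod_filter_not _ _ _).symm
    have e2 : ∏ v with v ∈ W, k v =
        (∏ v with v ∈ K, k v) * ∏ v with v ∈ W ∧ v ∉ K, k v := by
      rw [← Finset.prod_filter_mul_prod_filter_not (Finset.univ.filter (· ∈ W)) (· ∈ K),
        Finset.filter_filter, Finset.filter_filter]
      congr 2
      ext v
      simp only [Finset.mem_filter, Finset.mem_univ, true_and, and_iff_right_iff_imp]
      exact fun h => hKW h
    rw [e1, e2, ha, hb]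
    ring
  have hab_dep : DependsOn (a * b) (F₃ : Set V)ᶜ := by
    refine ((ha_dep.mono Set.subset_union_left).mul_fun (hb_dep.mono Set.subset_union_right)).mono ?_
    rintro v hv
    simp only [F₃, Finset.coe_filter, Finset.mem_univ, true_and, Set.mem_compl_iff,
      Set.mem_ofPred_eq, not_not]
    rcases hv with hv | hv | hv
    exacts [hv.1, hHW hv, hCW hv]
  have hb' : DependsOn (lmarginal μ F₂ b) (F₁ : Set V)ᶜ := by
    refine (hb_dep.lmarginal F₂).mono ?_
    rintro v ⟨hv | hv, hv'⟩
    · exact absurd (by simpa [F₂] using hv) hv'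
    · simp only [F₁, Finset.coe_filter, Finset.mem_univ, true_and, Set.mem_compl_iff,
        Set.mem_ofPred_eq]
      tauto
  have ha' : DependsOn a (F₂ : Set V)ᶜ := ha_dep.mono fun v hv => by
    simpa [F₂] using hv.2
  rw [hsplit, hfact, lmarginal_union μ _ ((ham.mul hbm).mul (hprod _)) h123,
    lmarginal_mul_left hab_dep (hprod _), lmarginal_prod_kernel_eq_one hr hk hdep hint, mul_one,
    lmarginal_union μ _ (ham.mul hbm) h12, lmarginal_mul_left ha' hbm,
    lmarginal_mul_right hb' ham]

end Marginals

/-! ### Moral graphs of ancestral sets. -/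

section Moralization

variable {V : Type*}

/-- The vertices from which `Q` can be reached along `r`, including `Q` itself. -/
def ancestralSet (r : V → V → Prop) (Q : Set V) : Set V :=
  {v | ∃ q ∈ Q, Relation.ReflTransGen r v q}

/-- Adjacency, after deletion of `C`, in the moral graph of the ancestral set of `Q`. -/
def MoralAdj (r : V → V → Prop) (Q C : Set V) (u v : V) : Prop :=
  u ∉ C ∧ v ∉ C ∧ ∃ w ∈ ancestralSet r Q, (u = w ∨ r u w) ∧ (v = w ∨ r v w)

/-- The vertices that are connected to `B` in the moral graph without `C`. -/
def moralComponent (r : V → V → Prop) (Q C B : Set V) : Set V :=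
  {v | ∃ b ∈ B, Relation.ReflTransGen (MoralAdj r Q C) b v}

/-- The ancestral vertices whose family (themselves and their parents) meets the component
of `B`. -/
def componentFamilies (r : V → V → Prop) (Q C B : Set V) : Set V :=
  {w | w ∈ ancestralSet r Q ∧ ∃ u ∈ moralComponent r Q C B, u = w ∨ r u w}

variable {r r' : V → V → Prop} {Q C B : Set V}

theorem subset_ancestralSet : Q ⊆ ancestralSet r Q := fun v hv => ⟨v, hv, .refl⟩

theorem mem_ancestralSet_of_rel {u v : V} (h : r u v) (hv : v ∈ ancestralSet r Q) :
    u ∈ ancestralSet r Q := by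
  obtain ⟨q, hq, hvq⟩ := hv
  exact ⟨q, hq, .head h hvq⟩

theorem MoralAdj.symm {u v : V} (h : MoralAdj r Q C u v) : MoralAdj r Q C v u := by
  obtain ⟨hu, hv, w, hw, huw, hvw⟩ := h
  exact ⟨hv, hu, w, hw, hvw, huw⟩

theorem moralComponent_subset_ancestralSet (hBQ : B ⊆ Q) :
    moralComponent r Q C B ⊆ ancestralSet r Q := by
  rintro v ⟨b, hb, hbv⟩
  induction hbv with
  | refl => exact subset_ancestralSet (hBQ hb)
  | tail _ h _ =>
    obtain ⟨-, -, w, hw, -, rfl | hvw⟩ := h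
    · exact hw
    · exact mem_ancestralSet_of_rel hvw hw

theorem disjoint_moralComponent (hBC : Disjoint B C) : Disjoint (moralComponent r Q C B) C := by
  rw [Set.disjoint_left]
  rintro v ⟨b, hb, hbv⟩
  induction hbv with
  | refl => exact Set.disjoint_left.1 hBC hb
  | tail _ h _ => exact h.2.1

theorem subset_moralComponent : B ⊆ moralComponent r Q C B := fun b hb => ⟨b, hb, .refl⟩

theorem mem_moralComponent_of_family (hBC : Disjoint B C) {v w : V}
    (hw : w ∈ componentFamilies r Q C B) (hv : v = w ∨ r v w) (hvC : v ∉ C) :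
    v ∈ moralComponent r Q C B := by
  obtain ⟨hwW, u, hu, huw⟩ := hw
  have huC : u ∉ C := Set.disjoint_left.1 (disjoint_moralComponent hBC) hu
  obtain ⟨b, hb, hbu⟩ := hu
  exact ⟨b, hb, hbu.tail ⟨huC, hvC, w, hwW, huw, hv⟩⟩

theorem insert_parents_subset_of_mem_componentFamilies (hBC : Disjoint B C) {w : V}
    (hw : w ∈ componentFamilies r Q C B) :
    insert w {u | r u w} ⊆ moralComponent r Q C B ∪ C := by
  intro v hv
  by_cases hvC : v ∈ C
  · exact Or.inr hvC
  · exact Or.inl (mem_moralComponent_of_family hBC hw hv hvC)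

/-- Follow a directed `r`-path from `w` to `Q`. Until it meets `C ⊆ Q`, its vertices lie in the
component, so each next vertex is again in `componentFamilies` and the edge into it is also an
`r'`-edge. Hence agreement on these families suffices, even if the ancestral sets differ elsewhere.
-/
theorem componentFamilies_subset_ancestralSet (hBC : Disjoint B C) (hCQ : C ⊆ Q)
    (h : ∀ w ∈ componentFamilies r Q C B, ∀ u, r u w → r' u w) :
    componentFamilies r Q C B ⊆ ancestralSet r' Q := by
  intro w hw
  obtain ⟨q, hq, hwq⟩ := hw.1
  induction hwq using Relation.ReflTransGen.head_induction_on with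
  | refl => exact subset_ancestralSet hq
  | @head a c hac hcq ih =>
    by_cases haC : a ∈ C
    · exact subset_ancestralSet (hCQ haC)
    have hc : c ∈ componentFamilies r Q C B :=
      ⟨⟨q, hq, hcq⟩, a, mem_moralComponent_of_family hBC hw (Or.inl rfl) haC, Or.inr hac⟩
    exact mem_ancestralSet_of_rel (h c hc a hac) (ih hc)

theorem moralComponent_mono_rel (hBC : Disjoint B C) (hCQ : C ⊆ Q)
    (h : ∀ w ∈ componentFamilies r Q C B, ∀ u, r u w → r' u w) :
    moralComponent r Q C B ⊆ moralComponent r' Q C B := by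
  rintro v ⟨b, hb, hbv⟩
  induction hbv with
  | refl => exact subset_moralComponent hb
  | @tail u v hbu huv ih =>
    obtain ⟨b', hb', hbu'⟩ := ih
    obtain ⟨huC, hvC, w, hw, huw, hvw⟩ := huv
    have hwK : w ∈ componentFamilies r Q C B := ⟨hw, u, ⟨b, hb, hbu⟩, huw⟩
    exact ⟨b', hb', hbu'.tail ⟨huC, hvC, w,
      componentFamilies_subset_ancestralSet hBC hCQ h hwK,
      huw.imp_right (h w hwK u), hvw.imp_right (h w hwK v)⟩⟩

theorem componentFamilies_mono_rel (hBC : Disjoint B C) (hCQ : C ⊆ Q)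
    (h : ∀ w ∈ componentFamilies r Q C B, ∀ u, r u w → r' u w) :
    componentFamilies r Q C B ⊆ componentFamilies r' Q C B := by
  intro w hw
  obtain ⟨-, u, hu, huw⟩ := id hw
  exact ⟨componentFamilies_subset_ancestralSet hBC hCQ h hw, u,
    moralComponent_mono_rel hBC hCQ h hu, huw.imp_right (h w hw u)⟩

end Moralization

/-! ### Active m-paths and their comparison with moral separation. -/

section ActivePaths

variable {ι V : Type*} {M : Digraph (ι × Option V)}

/-- An m-path on which all m-colliders and no non-m-colliders are in `F`. -/
def MPath.IsActive {x y w : Option V} (π : MPath M x y w) (F : Set (Option V)) : Prop :=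
  (∀ z ∈ π.mColliders, z ∈ F) ∧ ∀ z ∈ π.nonMColliders, z ∉ F

variable (M) in
/-- `x` is in `E`, or an active m-path from `x` to `E` starts with an edge out of `x` in the
sub-DAG `i`. -/
def ReachesByTail (i : ι) (E F : Set (Option V)) (x : Option V) : Prop :=
  x ∈ E ∨ ∃ y, M.Adj (i, x) (i, y) ∧ ∃ w ∈ E, ∃ π : MPath M x y w, π.IsActive F

variable (M) in
/-- An active m-path from `x` to `E` starts with an edge into `x` in the sub-DAG `i`. -/
def ReachesByHead (i : ι) (E F : Set (Option V)) (x : Option V) : Prop :=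
  ∃ y, M.Adj (i, y) (i, x) ∧ ∃ w ∈ E, ∃ π : MPath M x y w, π.IsActive F

variable {i : ι} {D E F : Set (Option V)} {x y : Option V}

theorem MPath.IsActive.cons_nonMCollider {z w : Option V} {π : MPath M y z w}
    (h : π.IsActive F) (hy : y ∉ F) (hxyz : NonColliderIn M i x y z) :
    (MPath.nonMCollider x y z w ⟨i, hxyz⟩ π).IsActive F :=
  ⟨h.1, by
    rintro a (rfl | ha)
    exacts [hy, h.2 a ha]⟩

theorem MPath.IsActive.cons_mCollider {z w : Option V} {π : MPath M y z w}
    (h : π.IsActive F) (hy : y ∈ F) (hxyz : ColliderIn M i x y z) :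
    (MPath.mCollider x y z w (Or.inl ⟨i, hxyz⟩) π).IsActive F :=
  ⟨by
    rintro a (rfl | ha)
    exacts [hy, h.1 a ha], h.2⟩

theorem ReachesByTail.of_child (h : ReachesByTail M i E F y) (hxy : M.Adj (i, x) (i, y))
    (hy : y ∉ F) : ReachesByTail M i E F x := by
  right
  refine ⟨y, hxy, ?_⟩
  rcases h with hyE | ⟨z, hyz, w, hw, π, hπ⟩
  · exact ⟨y, hyE, .edge x y ⟨i, Or.inl hxy⟩, by simp [MPath.IsActive, MPath.mColliders,
      MPath.nonMColliders]⟩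
  · exact ⟨w, hw, _, hπ.cons_nonMCollider hy (Or.inl ⟨hxy, hyz⟩)⟩

theorem ReachesByTail.head_of_parent (h : ReachesByTail M i E F x) (hxy : M.Adj (i, x) (i, y))
    (hx : x ∉ F) : ReachesByHead M i E F y := by
  refine ⟨x, hxy, ?_⟩
  rcases h with hxE | ⟨z, hxz, w, hw, π, hπ⟩
  · exact ⟨x, hxE, .edge y x ⟨i, Or.inr hxy⟩, by simp [MPath.IsActive, MPath.mColliders,
      MPath.nonMColliders]⟩
  · exact ⟨w, hw, _, hπ.cons_nonMCollider hx (Or.inr (Or.inr ⟨hxy, hxz⟩))⟩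

theorem ReachesByHead.head_of_parent (h : ReachesByHead M i E F x) (hxy : M.Adj (i, x) (i, y))
    (hx : x ∉ F) : ReachesByHead M i E F y := by
  obtain ⟨z, hzx, w, hw, π, hπ⟩ := h
  exact ⟨x, hxy, w, hw, _, hπ.cons_nonMCollider hx (Or.inr (Or.inl ⟨hxy, hzx⟩))⟩

theorem ReachesByHead.tail_of_collider (h : ReachesByHead M i E F y) (hxy : M.Adj (i, x) (i, y))
    (hy : y ∈ F) : ReachesByTail M i E F x := by
  obtain ⟨z, hzy, w, hw, π, hπ⟩ := h
  exact Or.inr ⟨y, hxy, w, hw, _, hπ.cons_mCollider hy ⟨hxy, hzy⟩⟩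

theorem MDSeparated.not_reachesByHead (h : MDSeparated M D E F) (hx : x ∈ D) :
    ¬ ReachesByHead M i E F x := fun ⟨y, _, w, hw, π, hπ⟩ => h ⟨x, hx, w, hw, y, π, hπ⟩

theorem MDSeparated.not_reachesByTail (h : MDSeparated M D E F) (hDE : Disjoint D E)
    (hx : x ∈ D) : ¬ ReachesByTail M i E F x := by
  rintro (hxE | ⟨y, _, w, hw, π, hπ⟩)
  · exact Set.disjoint_left.1 hDE hx hxE
  · exact h ⟨x, hx, w, hw, y, π, hπ⟩

variable {A B C : Set V}

/-- The edges among `X` of the sub-DAG `i`. -/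
def xAdj (M : Digraph (ι × Option V)) (i : ι) (u v : V) : Prop :=
  M.Adj (i, some u) (i, some v)

/-- A walk arriving at `v` against an arrow can turn: descend from `v` towards `A ∪ B ∪ C`. If the
descent meets `C`, the vertex met is a collider and the walk returns the way it came, which is
legitimate since vertices may recur. Otherwise it ends in `B`, or in `A`, where an active m-path
from `A` to `B` would contradict separation. -/
theorem ReachesByHead.tail_of_mem_ancestralSet
    (hsep : MDSeparated M (some '' A) (some '' B) (some '' C)) {v : V} (hvC : v ∉ C)
    (hv : v ∈ ancestralSet (xAdj M i) (A ∪ B ∪ C))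
    (h : ReachesByHead M i (some '' B) (some '' C) (some v)) :
    ReachesByTail M i (some '' B) (some '' C) (some v) := by
  have hC : ∀ {u : V}, u ∉ C → some u ∉ some '' C := by simp
  obtain ⟨q, hq, hvq⟩ := hv
  induction hvq using Relation.ReflTransGen.head_induction_on with
  | refl =>
    rcases hq with (hqA | hqB) | hqC
    · exact absurd h (hsep.not_reachesByHead ⟨q, hqA, rfl⟩)
    · exact Or.inl ⟨q, hqB, rfl⟩
    · exact absurd hqC hvC
  | @head a c hac _ ih =>
    have hc : ReachesByHead M i (some '' B) (some '' C) (some c) := h.head_of_parent hac (hC hvC)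
    by_cases hcC : c ∈ C
    · exact hc.tail_of_collider hac ⟨c, hcC, rfl⟩
    · exact (ih hcC hc).of_child hac (hC hcC)

/-- Active m-paths to `B` propagate within the family of an ancestral vertex. -/
theorem ReachesByTail.of_family
    (hsep : MDSeparated M (some '' A) (some '' B) (some '' C)) {x y : Option V} {w : V}
    (hw : w ∈ ancestralSet (xAdj M i) (A ∪ B ∪ C)) (hx : x ∉ some '' C) (hy : y ∉ some '' C)
    (hxw : x = some w ∨ M.Adj (i, x) (i, some w)) (hyw : y = some w ∨ M.Adj (i, y) (i, some w))
    (h : ReachesByTail M i (some '' B) (some '' C) x) :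
    ReachesByTail M i (some '' B) (some '' C) y := by
  have hC : ∀ {u : V}, some u ∉ some '' C → u ∉ C := by simp
  have key : ReachesByTail M i (some '' B) (some '' C) (some w) → some w ∉ some '' C →
      ReachesByTail M i (some '' B) (some '' C) y := by
    intro hU hwC
    rcases hyw with rfl | hyw
    · exact hU
    · exact hU.of_child hyw hwC
  rcases hxw with rfl | hxw
  · exact key h hx
  -- The m-path now enters `w` from `x`. If `w` is in `C`, it is a collider between two married
  -- parents; if not, the ancestral detour turns the arrival at `w` into a departure.
  have hD := h.head_of_parent hxw hx
  by_cases hwC : some w ∈ some '' C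
  · rcases hyw with rfl | hyw
    · exact absurd hwC hy
    · exact hD.tail_of_collider hyw hwC
  · exact key (hD.tail_of_mem_ancestralSet hsep (hC hwC) hw) hwC

theorem ReachesByTail.of_moralAdj
    (hsep : MDSeparated M (some '' A) (some '' B) (some '' C)) {u v : V}
    (huv : Relation.ReflTransGen (MoralAdj (xAdj M i) (A ∪ B ∪ C) C) u v)
    (h : ReachesByTail M i (some '' B) (some '' C) (some u)) :
    ReachesByTail M i (some '' B) (some '' C) (some v) := by
  induction huv with
  | refl => exact h
  | tail _ hadj ih =>
    obtain ⟨hu, hv, w, hw, huw, hvw⟩ := hadj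
    exact ReachesByTail.of_family hsep hw (by simpa using hu) (by simpa using hv)
      (huw.imp_left (congrArg some)) (hvw.imp_left (congrArg some)) ih

theorem disjoint_moralComponent_of_mdSeparated (hAB : Disjoint A B)
    (hsep : MDSeparated M (some '' A) (some '' B) (some '' C)) :
    Disjoint A (moralComponent (xAdj M i) (A ∪ B ∪ C) C B) := by
  rw [Set.disjoint_left]
  rintro a ha ⟨b, hb, hba⟩
  exact hsep.not_reachesByTail ((Set.disjoint_image_iff (Option.some_injective V)).2 hAB)
    ⟨a, ha, rfl⟩ (ReachesByTail.of_moralAdj hsep hba (Or.inl ⟨b, hb, rfl⟩))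

theorem disjoint_moralComponent_of_mdSeparated' (hAB : Disjoint A B)
    (hsep : MDSeparated M (some '' A) (some '' B) (some '' C)) :
    Disjoint B (moralComponent (xAdj M i) (A ∪ B ∪ C) C A) := by
  rw [Set.disjoint_left]
  rintro b hb ⟨a, ha, hab⟩
  have : Std.Symm (MoralAdj (xAdj M i) (A ∪ B ∪ C) C) := ⟨fun _ _ h => h.symm⟩
  exact Set.disjoint_left.1 (disjoint_moralComponent_of_mdSeparated hAB hsep) ha
    ⟨b, hb, Std.Symm.symm _ _ hab⟩

theorem reachesByTail_none_of_componentFamilies (hBC : Disjoint B C)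
    (hsep : MDSeparated M (some '' A) (some '' B) (some '' C)) {w : V}
    (hw : w ∈ componentFamilies (xAdj M i) (A ∪ B ∪ C) C B)
    (hT : M.Adj (i, none) (i, some w)) :
    ReachesByTail M i (some '' B) (some '' C) none := by
  obtain ⟨hwW, u, hu, huw⟩ := hw
  have huC : u ∉ C := Set.disjoint_left.1 (disjoint_moralComponent hBC) hu
  obtain ⟨b, hb, hbu⟩ := hu
  exact ReachesByTail.of_family hsep hwW (by simpa using huC) (by simp)
    (huw.imp_left (congrArg some)) (Or.inr hT)
    (ReachesByTail.of_moralAdj hsep hbu (Or.inl ⟨b, hb, rfl⟩))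

/-- An active m-path from `T` to `B` would pass to the family of `w`, where `T` acts as one more
parent not in `C`, and then along the moral component back to `A`. -/
theorem not_reachesByTail_none_of_componentFamilies (hAB : Disjoint A B) (hAC : Disjoint A C)
    (hsep : MDSeparated M (some '' A) (some '' B) (some '' C)) {w : V}
    (hw : w ∈ componentFamilies (xAdj M i) (A ∪ B ∪ C) C A)
    (hT : M.Adj (i, none) (i, some w)) :
    ¬ ReachesByTail M i (some '' B) (some '' C) none := by
  intro h
  obtain ⟨hwW, u, hu, huw⟩ := hw
  have huC : u ∉ C := Set.disjoint_left.1 (disjoint_moralComponent hAC) hu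
  obtain ⟨a, ha, hau⟩ := hu
  have : Std.Symm (MoralAdj (xAdj M i) (A ∪ B ∪ C) C) := ⟨fun _ _ h => h.symm⟩
  exact hsep.not_reachesByTail ((Set.disjoint_image_iff (Option.some_injective V)).2 hAB)
    ⟨a, ha, rfl⟩ (ReachesByTail.of_moralAdj hsep (Std.Symm.symm _ _ hau)
      (ReachesByTail.of_family hsep hwW (by simp) (by simpa using huC) (Or.inr hT)
        (huw.imp_left (congrArg some)) h))

end ActivePaths

/-! ### Factorization of the mixture density. -/

namespace MixtureOfDAGs

variable {V : Type*} [Fintype V] [DecidableEq V] {𝓧 : V → Type*}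
  [∀ v, MeasurableSpace (𝓧 v)] {μ : ∀ v, Measure (𝓧 v)}
  {𝒯 : Type*} [MeasurableSpace 𝒯] {ν : Measure 𝒯}

/-- The edges among `X` of the DAG `G^t`. -/
def xEdge (D : MixtureOfDAGs V 𝓧 μ 𝒯 ν) (t : 𝒯) (u v : V) : Prop :=
  (D.dag t).Adj (some u) (some v)

/-- The conditional densities with values in `ℝ≥0∞`. -/
noncomputable def ekernel (D : MixtureOfDAGs V 𝓧 μ 𝒯 ν) (t : 𝒯) (v : V) (x : ∀ u, 𝓧 u) : ℝ≥0∞ :=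
  D.kernel v t x

variable (D : MixtureOfDAGs V 𝓧 μ 𝒯 ν)

theorem measurable_uncurry_prod_ekernel :
    Measurable fun p : 𝒯 × (∀ u, 𝓧 u) => (∏ v, D.ekernel p.1 v) p.2 := by
  simp only [Finset.prod_apply]
  exact Finset.measurable_prod _ fun v _ => (D.measurable_kernel v).coe_nnreal_ennreal

theorem measurable_ekernel (t : 𝒯) (v : V) : Measurable (D.ekernel t v) :=
  ((D.measurable_kernel v).comp measurable_prodMk_left).coe_nnreal_ennreal

theorem density_eq (x : ∀ v, 𝓧 v) :
    D.density x = ∫⁻ t, D.timeDensity t * (∏ v, D.ekernel t v) x ∂ν := by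
  simp [density, ekernel, Finset.prod_apply]

theorem measurable_density [SigmaFinite ν] : Measurable D.density := by
  have : D.density = fun x => ∫⁻ t, D.timeDensity t * (∏ v, D.ekernel t v) x ∂ν :=
    funext D.density_eq
  rw [this]
  refine Measurable.lintegral_prod_left' (f := fun p : 𝒯 × (∀ u, 𝓧 u) =>
    (D.timeDensity p.1 : ℝ≥0∞) * (∏ v, D.ekernel p.1 v) p.2) ?_
  exact (D.measurable_timeDensity.comp measurable_fst).coe_nnreal_ennreal.mul
    D.measurable_uncurry_prod_ekernel

variable {D}

theorem xEdge_acyclic {t : 𝒯} (ht : D.timeDensity t ≠ 0) (v : V) :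
    ¬ Relation.TransGen (D.xEdge t) v v := fun h =>
  D.acyclic t ht (some v) (h.lift some fun _ _ hab => hab)

theorem dependsOn_ekernel {t : 𝒯} (ht : D.timeDensity t ≠ 0) (v : V) :
    DependsOn (D.ekernel t v) (insert v {u | D.xEdge t u v}) := fun _ _ h =>
  congrArg ENNReal.ofNNReal (D.kernel_dependsOn t ht v h)

/-- This is the only place where the meaning of `X^∅` enters the factorization: a non-child of `T`
belongs to it. -/
theorem xEdge_congr_of_not_time_parent {s t : 𝒯} (hs : D.timeDensity s ≠ 0)
    (ht : D.timeDensity t ≠ 0) {w : V} (hw : ¬ (D.dag s).Adj none (some w)) :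
    (∀ u, D.xEdge s u w ↔ D.xEdge t u w) ∧ D.ekernel s w = D.ekernel t w := by
  rw [D.time_parent s hs, not_not] at hw
  obtain ⟨h1, h2⟩ := hw s hs t ht
  refine ⟨fun u => ?_, ?_⟩
  · exact Set.ext_iff.1 h1 u
  · ext x
    simp [ekernel, h2]

variable {A B C Q : Set V}

section Factorization

variable (hBC : Disjoint B C) (hCQ : C ⊆ Q)
  (hT : ∀ t, D.timeDensity t ≠ 0 → ∀ w ∈ componentFamilies (D.xEdge t) Q C B,
    ¬ (D.dag t).Adj none (some w))

include hBC hCQ hT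

theorem moralComponent_congr {s t : 𝒯} (hs : D.timeDensity s ≠ 0) (ht : D.timeDensity t ≠ 0) :
    moralComponent (D.xEdge s) Q C B = moralComponent (D.xEdge t) Q C B := by
  have key : ∀ s t, D.timeDensity s ≠ 0 → D.timeDensity t ≠ 0 →
      moralComponent (D.xEdge s) Q C B ⊆ moralComponent (D.xEdge t) Q C B := fun s t hs ht =>
    moralComponent_mono_rel hBC hCQ fun w hw u =>
      ((xEdge_congr_of_not_time_parent hs ht (hT s hs w hw)).1 u).1
  exact (key s t hs ht).antisymm (key t s ht hs)

theorem componentFamilies_congr {s t : 𝒯} (hs : D.timeDensity s ≠ 0) (ht : D.timeDensity t ≠ 0) :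
    componentFamilies (D.xEdge s) Q C B = componentFamilies (D.xEdge t) Q C B := by
  have key : ∀ s t, D.timeDensity s ≠ 0 → D.timeDensity t ≠ 0 →
      componentFamilies (D.xEdge s) Q C B ⊆ componentFamilies (D.xEdge t) Q C B := fun s t hs ht =>
    componentFamilies_mono_rel hBC hCQ fun w hw u =>
      ((xEdge_congr_of_not_time_parent hs ht (hT s hs w hw)).1 u).1
  exact (key s t hs ht).antisymm (key t s ht hs)

open Classical in
/-- If `T` is not a parent of the families that meet the component of `B`, then the conditional
density of `X` given `T = t` factorizes with a factor for `B` that does not depend on `t`. -/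
theorem exists_lmarginal_prod_ekernel_factorization [∀ v, SigmaFinite (μ v)] (hAQ : A ⊆ Q)
    (hBQ : B ⊆ Q)
    (hA : ∀ t, D.timeDensity t ≠ 0 → Disjoint A (moralComponent (D.xEdge t) Q C B)) :
    ∃ β : ((∀ v, 𝓧 v) → ℝ≥0∞) → (∀ v, 𝓧 v) → ℝ≥0∞, ∀ t, D.timeDensity t ≠ 0 →
      ∃ α : ((∀ v, 𝓧 v) → ℝ≥0∞) → (∀ v, 𝓧 v) → ℝ≥0∞,
        ∀ φ ψ : (∀ v, 𝓧 v) → ℝ≥0∞, Measurable φ → Measurable ψ → DependsOn φ A → DependsOn ψ B →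
          lmarginal μ (Finset.univ.filter (· ∉ C)) (φ * ψ * ∏ v, D.ekernel t v) =
            α φ * β ψ := by
  by_cases hS : ∃ s, D.timeDensity s ≠ 0
  swap
  · exact ⟨fun _ => 0, fun t ht => absurd ⟨t, ht⟩ hS⟩
  obtain ⟨s, hs⟩ := hS
  -- `β` is built at a reference point `s` of the support. The component and its families agree at
  -- every other `t`; the ancestral set need not, and it enters only `α`.
  refine ⟨fun ψ => lmarginal μ (Finset.univ.filter (· ∈ moralComponent (D.xEdge s) Q C B))
    (ψ * ∏ v with v ∈ componentFamilies (D.xEdge s) Q C B, D.ekernel s v), fun t ht => ?_⟩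
  refine ⟨fun φ => lmarginal μ (Finset.univ.filter fun v => v ∈ ancestralSet (D.xEdge t) Q ∧
      v ∉ moralComponent (D.xEdge t) Q C B ∧ v ∉ C)
    (φ * ∏ v with v ∈ ancestralSet (D.xEdge t) Q ∧ v ∉ componentFamilies (D.xEdge t) Q C B,
      D.ekernel t v), fun φ ψ hφ hψ hφA hψB => ?_⟩
  have hk : ∏ v with v ∈ componentFamilies (D.xEdge s) Q C B, D.ekernel s v =
      ∏ v with v ∈ componentFamilies (D.xEdge s) Q C B, D.ekernel t v :=
    Finset.prod_congr rfl fun w hw => (xEdge_congr_of_not_time_parent hs ht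
      (hT s hs w (Finset.mem_filter.1 hw).2)).2
  simp only [hk]
  rw [moralComponent_congr hBC hCQ hT hs ht, componentFamilies_congr hBC hCQ hT hs ht]
  exact lmarginal_compl_mul_mul_prod (xEdge_acyclic ht) (D.measurable_ekernel t)
    (dependsOn_ekernel ht) (D.lintegral_kernel t ht) (hCQ.trans subset_ancestralSet)
    (fun _ _ => mem_ancestralSet_of_rel) (moralComponent_subset_ancestralSet hBQ)
    (disjoint_moralComponent hBC) (fun _ => Iff.rfl)
    (fun _ => insert_parents_subset_of_mem_componentFamilies hBC) hφ hψ
    (hφA.mono fun a ha => ⟨subset_ancestralSet (hAQ ha), Set.disjoint_left.1 (hA t ht) ha⟩)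
    (hψB.mono subset_moralComponent)

end Factorization

variable [∀ v, SigmaFinite (μ v)]

theorem measurable_lmarginal_prod_ekernel (s : Finset V) {φ : (∀ v, 𝓧 v) → ℝ≥0∞}
    (hφ : Measurable φ) (x : ∀ v, 𝓧 v) :
    Measurable fun t => lmarginal μ s (φ * ∏ v, D.ekernel t v) x := by
  unfold lmarginal
  refine Measurable.lintegral_prod_right' (f := fun p : 𝒯 × (∀ i : s, 𝓧 i) =>
    (φ * ∏ v, D.ekernel p.1 v) (Function.updateFinset x s p.2)) ?_
  have hu : Measurable fun p : 𝒯 × (∀ i : s, 𝓧 i) => Function.updateFinset x s p.2 :=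
    measurable_updateFinset.comp measurable_snd
  exact (hφ.comp hu).mul (D.measurable_uncurry_prod_ekernel.comp (measurable_fst.prodMk hu))

theorem lmarginal_mul_density [SigmaFinite ν] (s : Finset V) {φ : (∀ v, 𝓧 v) → ℝ≥0∞}
    (hφ : Measurable φ) (x : ∀ v, 𝓧 v) :
    lmarginal μ s (φ * D.density) x =
      ∫⁻ t, D.timeDensity t * lmarginal μ s (φ * ∏ v, D.ekernel t v) x ∂ν := by
  have hu : Measurable fun p : (∀ i : s, 𝓧 i) × 𝒯 => Function.updateFinset x s p.1 :=
    measurable_updateFinset.comp measurable_fst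
  have hf : Measurable fun p : (∀ i : s, 𝓧 i) × 𝒯 => (D.timeDensity p.2 : ℝ≥0∞) *
      (φ * ∏ v, D.ekernel p.2 v) (Function.updateFinset x s p.1) :=
    (D.measurable_timeDensity.comp measurable_snd).coe_nnreal_ennreal.mul
      ((hφ.comp hu).mul (D.measurable_uncurry_prod_ekernel.comp (measurable_snd.prodMk hu)))
  have h1 : lmarginal μ s (φ * D.density) x = ∫⁻ y, ∫⁻ t, D.timeDensity t *
      (φ * ∏ v, D.ekernel t v) (Function.updateFinset x s y) ∂ν
        ∂(Measure.pi fun i : s => μ i) := by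
    unfold lmarginal
    refine lintegral_congr fun y => ?_
    rw [Pi.mul_apply, density_eq, ← lintegral_const_mul]
    · refine lintegral_congr fun t => ?_
      rw [Pi.mul_apply]
      ring
    · exact D.measurable_timeDensity.coe_nnreal_ennreal.mul
        (D.measurable_uncurry_prod_ekernel.comp measurable_prodMk_right)
  rw [h1, lintegral_lintegral_swap hf.aemeasurable]
  refine lintegral_congr fun t => ?_
  unfold lmarginal
  rw [lintegral_const_mul]
  refine Measurable.comp (g := φ * ∏ v, D.ekernel t v) (hφ.mul ?_) measurable_updateFinset
  exact D.measurable_uncurry_prod_ekernel.comp measurable_prodMk_left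

open Classical in
theorem lmarginal_density_mul_eq [SigmaFinite ν] (hBC : Disjoint B C) (hCQ : C ⊆ Q)
    (hT : ∀ t, D.timeDensity t ≠ 0 → ∀ w ∈ componentFamilies (D.xEdge t) Q C B,
      ¬ (D.dag t).Adj none (some w)) (hAQ : A ⊆ Q) (hBQ : B ⊆ Q)
    (hA : ∀ t, D.timeDensity t ≠ 0 → Disjoint A (moralComponent (D.xEdge t) Q C B))
    {φ ψ : (∀ v, 𝓧 v) → ℝ≥0∞} (hφ : Measurable φ) (hψ : Measurable ψ) (hφA : DependsOn φ A)
    (hψB : DependsOn ψ B) :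
    lmarginal μ (Finset.univ.filter (· ∉ C)) (φ * ψ * D.density) *
        lmarginal μ (Finset.univ.filter (· ∉ C)) D.density =
      lmarginal μ (Finset.univ.filter (· ∉ C)) (φ * D.density) *
        lmarginal μ (Finset.univ.filter (· ∉ C)) (ψ * D.density) := by
  obtain ⟨β, hβ⟩ := exists_lmarginal_prod_ekernel_factorization hBC hCQ hT hAQ hBQ hA
  have hone : Measurable (1 : (∀ v, 𝓧 v) → ℝ≥0∞) := measurable_one
  have hone' : ∀ s : Set V, DependsOn (1 : (∀ v, 𝓧 v) → ℝ≥0∞) s := fun _ _ _ _ => rfl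
  have hmeas : ∀ {χ : (∀ v, 𝓧 v) → ℝ≥0∞}, Measurable χ → ∀ x, AEMeasurable (fun t =>
      (D.timeDensity t : ℝ≥0∞) *
        lmarginal μ (Finset.univ.filter (· ∉ C)) (χ * ∏ v, D.ekernel t v) x) ν := fun hχ x =>
    (D.measurable_timeDensity.coe_nnreal_ennreal.mul
      (measurable_lmarginal_prod_ekernel _ hχ x)).aemeasurable
  ext x
  -- A factor `1` is inserted so that the marginal of the bare density also has a test function.
  rw [← one_mul D.density, ← mul_assoc, ← mul_assoc, ← mul_assoc]
  simp only [Pi.mul_apply, mul_one]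
  rw [lmarginal_mul_density _ (hφ.mul hψ), lmarginal_mul_density _ hφ,
    lmarginal_mul_density _ hψ, lmarginal_mul_density _ hone,
    ← lintegral_lintegral_mul (hmeas (hφ.mul hψ) x) (hmeas hone x),
    ← lintegral_lintegral_mul (hmeas hφ x) (hmeas hψ x)]
  -- Both sides are now double integrals over `(s, t)`. Their integrands agree pointwise: exchanging
  -- `β ψ` and `β 1` between `s` and `t` is harmless because `β` depends on neither.
  refine lintegral_congr fun s => lintegral_congr fun t => ?_
  by_cases hs : D.timeDensity s = 0
  · simp [hs]
  by_cases ht : D.timeDensity t = 0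
  · simp [ht]
  obtain ⟨α, hα⟩ := hβ s hs
  obtain ⟨α', hα'⟩ := hβ t ht
  have e1 := hα φ ψ hφ hψ hφA hψB
  have e2 := hα φ 1 hφ hone hφA (hone' B)
  have e3 := hα' 1 ψ hone hψ (hone' A) hψB
  have e4 := hα' 1 1 hone hone (hone' A) (hone' B)
  rw [mul_one] at e2 e4
  rw [one_mul] at e3
  rw [e1, e2, e3, e4]
  simp only [Pi.mul_apply]
  ring

end MixtureOfDAGs

/-! ### Conditional probabilities as quotients of marginals. -/

section ConditionalDensity

theorem dependsOn_indicator_subvector {V : Type*} {𝓧 : V → Type*} {A : Set V}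
    (s : Set (∀ a : A, 𝓧 a)) :
    DependsOn (Set.indicator ((fun (x : ∀ v, 𝓧 v) (a : A) => x a) ⁻¹' s) (1 : (∀ v, 𝓧 v) → ℝ≥0∞)) A := by
  intro x y h
  have : (fun a : A => x a) = fun a : A => y a := funext fun a => h a a.2
  have hiff : x ∈ (fun (x : ∀ v, 𝓧 v) (a : A) => x a) ⁻¹' s ↔
      y ∈ (fun (x : ∀ v, 𝓧 v) (a : A) => x a) ⁻¹' s := by
    change (fun a : A => x a) ∈ s ↔ (fun a : A => y a) ∈ s
    rw [this]
  by_cases hy : y ∈ (fun (x : ∀ v, 𝓧 v) (a : A) => x a) ⁻¹' s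
  · rw [Set.indicator_of_mem hy, Set.indicator_of_mem (hiff.2 hy), Pi.one_apply, Pi.one_apply]
  · rw [Set.indicator_of_notMem hy, Set.indicator_of_notMem (mt hiff.1 hy)]

variable {V : Type*} {𝓧 : V → Type*} [∀ v, MeasurableSpace (𝓧 v)]
  {Ω : Type*} {X : ∀ v, Ω → 𝓧 v}

theorem measurable_comap_subvector_of_dependsOn [Nonempty Ω] {C : Set V}
    {g : (∀ v, 𝓧 v) → ℝ≥0∞} (hg : Measurable g) (hgC : DependsOn g C) :
    Measurable[MeasurableSpace.comap (subvector X C) inferInstance]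
      fun ω => g fun v => X v ω := by
  classical
  obtain ⟨ω₀⟩ := ‹Nonempty Ω›
  -- The values outside `C` are irrelevant to `g`; the sample point `ω₀` supplies some.
  let e : (∀ a : C, 𝓧 a) → ∀ v, 𝓧 v := fun c v => if h : v ∈ C then c ⟨v, h⟩ else X v ω₀
  have he : Measurable e := by
    refine measurable_pi_lambda _ fun v => ?_
    by_cases h : v ∈ C
    · simpa [e, h] using measurable_pi_apply (⟨v, h⟩ : C)
    · simp [e, h]
  have : (fun ω => g fun v => X v ω) = (g ∘ e) ∘ subvector X C := by
    ext ω
    exact hgC fun v hv => by simp [e, hv, subvector]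
  rw [this]
  exact (hg.comp he).comp (comap_measurable _)

theorem measurableSet_preimage_subvector {A : Set V} {s : Set (∀ a : A, 𝓧 a)}
    (hs : MeasurableSet s) :
    MeasurableSet ((fun (x : ∀ v, 𝓧 v) (a : A) => x a) ⁻¹' s) :=
  (measurable_pi_lambda _ fun a : A => measurable_pi_apply (a : V)) hs

variable [DecidableEq V] {μ : ∀ v, Measure (𝓧 v)} {s : Finset V} {C : Set V}
  {f : (∀ v, 𝓧 v) → ℝ≥0∞}

theorem dependsOn_lmarginal_of_compl (hs : ∀ v, v ∈ s ↔ v ∉ C) :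
    DependsOn (lmarginal μ s f) C := by
  refine ((dependsOn_univ f).lmarginal s).mono fun v hv => ?_
  have : v ∉ s := hv.2
  rwa [hs, not_not] at this

variable [Fintype V] [∀ v, SigmaFinite (μ v)]

theorem ae_lmarginal_eq_top_imp (hs : ∀ v, v ∈ s ↔ v ∉ C) (hf : Measurable f)
    (hfin : ∫⁻ x, f x ∂(Measure.pi μ) ≠ ∞) :
    ∀ᵐ x ∂(Measure.pi μ), lmarginal μ s f x = ∞ → f x = 0 := by
  set p := lmarginal μ s f
  have hp : Measurable p := hf.lmarginal μ
  have hsC : (s : Set V)ᶜ = C := by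
    ext v
    simp [hs]
  have hN : MeasurableSet {x | p x = ∞} := hp (measurableSet_singleton _)
  set N := Set.indicator {x | p x = ∞} (1 : (∀ v, 𝓧 v) → ℝ≥0∞)
  have hNm : Measurable N := measurable_one.indicator hN
  have hpC : DependsOn p C := dependsOn_lmarginal_of_compl hs
  have hNC : DependsOn N (s : Set V)ᶜ := by
    rw [hsC]
    intro x y h
    simp only [N, Set.indicator, Set.mem_ofPred_eq, hpC h, Pi.one_apply]
  -- The marginal of `N * f` takes only the values `0` and `∞`, so doubling does not change it. The
  -- finite integral of `N * f` thus equals its double and vanishes.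
  have h2 : ∫⁻ x, (N * f) x ∂(Measure.pi μ) = ∫⁻ x, ((N + N) * f) x ∂(Measure.pi μ) := by
    refine lintegral_eq_of_lmarginal_eq s (hNm.mul hf) ((hNm.add hNm).mul hf) ?_
    rw [lmarginal_mul_left hNC hf, lmarginal_mul_left (fun x y h => by
      simp only [Pi.add_apply, hNC h]) hf]
    ext x
    by_cases hx : p x = ∞
    · have : lmarginal μ s f x = ∞ := hx
      simp [N, hx, this, Set.indicator]
    · simp [N, hx, Set.indicator]
  have h3 : ∫⁻ x, (N * f) x ∂(Measure.pi μ) = 0 := by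
    have hle : ∫⁻ x, (N * f) x ∂(Measure.pi μ) ≤ ∫⁻ x, f x ∂(Measure.pi μ) := by
      refine lintegral_mono fun x => ?_
      by_cases hx : p x = ∞ <;> simp [N, hx, Set.indicator]
    have hne := ne_top_of_le_ne_top hfin hle
    have h4 : ∫⁻ x, ((N + N) * f) x ∂(Measure.pi μ) =
        ∫⁻ x, (N * f) x ∂(Measure.pi μ) + ∫⁻ x, (N * f) x ∂(Measure.pi μ) := by
      rw [← lintegral_add_left (hNm.mul hf)]
      refine lintegral_congr fun x => ?_
      simp only [Pi.mul_apply, Pi.add_apply]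
      ring
    rw [h4] at h2
    exact (ENNReal.add_right_inj hne).1 (by rw [← h2, add_zero])
  filter_upwards [(lintegral_eq_zero_iff (hNm.mul hf)).1 h3] with x hx hpx
  have hpx' : p x = ∞ := hpx
  simpa [N, hpx', Set.indicator] using hx

variable [MeasurableSpace Ω] {P : Measure Ω} [IsProbabilityMeasure P]

/-- The conditional probability of `E` given `X_C`, in terms of the density of `X`. -/
theorem condExp_indicator_ae_eq_lmarginal_div (hX : ∀ v, Measurable (X v)) (hf : Measurable f)
    (hlaw : P.map (fun ω v => X v ω) = (Measure.pi μ).withDensity f)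
    (hs : ∀ v, v ∈ s ↔ v ∉ C) {E : Set (∀ v, 𝓧 v)} (hE : MeasurableSet E) :
    P⟦(fun ω v => X v ω) ⁻¹' E | MeasurableSpace.comap (subvector X C) inferInstance⟧ =ᵐ[P]
      fun ω => (lmarginal μ s (E.indicator 1 * f) (fun v => X v ω) /
        lmarginal μ s f (fun v => X v ω)).toReal := by
  have : Nonempty Ω := nonempty_of_isProbabilityMeasure P
  have hXm : Measurable fun ω v => X v ω := measurable_pi_lambda _ hX
  have hm := (measurable_subvector hX C).comap_le
  have hsC : (s : Set V)ᶜ = C := by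
    ext v
    simp [hs]
  have hfin : ∫⁻ x, f x ∂(Measure.pi μ) ≠ ∞ := by
    rw [← setLIntegral_univ, ← withDensity_apply _ MeasurableSet.univ, ← hlaw]
    have := Measure.isProbabilityMeasure_map (μ := P) hXm.aemeasurable
    exact measure_ne_top _ _
  have hint : ∀ g : (∀ v, 𝓧 v) → ℝ≥0∞, Measurable g →
      ∫⁻ ω, g (fun v => X v ω) ∂P = ∫⁻ x, (g * f) x ∂(Measure.pi μ) := fun g hg => by
    rw [← lintegral_map hg hXm, hlaw, lintegral_withDensity_eq_lintegral_mul _ hf hg, mul_comm]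
  have hEm : Measurable (E.indicator (1 : (∀ v, 𝓧 v) → ℝ≥0∞)) := measurable_one.indicator hE
  set p := lmarginal μ s f with hp_def
  set pE := lmarginal μ s (E.indicator 1 * f) with hpE_def
  have hp : Measurable p := hf.lmarginal μ
  have hpE : Measurable pE := (hEm.mul hf).lmarginal μ
  have hle : pE ≤ p := lmarginal_mono fun x => by
    by_cases hx : x ∈ E <;> simp [hx]
  set q : (∀ v, 𝓧 v) → ℝ≥0∞ := fun x => pE x / p x
  have hq : Measurable q := hpE.div hp
  have hpC : DependsOn p C := dependsOn_lmarginal_of_compl hs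
  have hpEC : DependsOn pE C := dependsOn_lmarginal_of_compl hs
  have hqC : DependsOn q C := fun x y h => by
    simp only [q]
    rw [hpC h, hpEC h]
  have hq1 : ∀ x, q x ≤ 1 := fun x => ENNReal.div_le_of_le_mul (by simpa using hle x)
  have hqX : Measurable[MeasurableSpace.comap (subvector X C) inferInstance]
      fun ω => (q fun v => X v ω).toReal :=
    (measurable_comap_subvector_of_dependsOn hq hqC).ennreal_toReal
  have hqint : Integrable (fun ω => (q fun v => X v ω).toReal) P := by
    refine Integrable.of_bound (hqX.mono hm le_rfl).aestronglyMeasurable 1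
      (Filter.Eventually.of_forall fun ω => ?_)
    rw [Real.norm_of_nonneg ENNReal.toReal_nonneg]
    exact ENNReal.toReal_le_of_le_ofReal zero_le_one (by simpa using hq1 _)
  symm
  refine ae_eq_condExp_of_forall_setIntegral_eq hm
    ((integrable_const (1 : ℝ)).indicator (hXm hE)) (fun _ _ _ => hqint.integrableOn) ?_
    hqX.stronglyMeasurable.aestronglyMeasurable
  rintro r ⟨r', hr', rfl⟩ -
  set R : Set (∀ v, 𝓧 v) := (fun (x : ∀ v, 𝓧 v) (a : C) => x a) ⁻¹' r'
  have hR : MeasurableSet R := measurableSet_preimage_subvector hr'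
  have hrR : subvector X C ⁻¹' r' = (fun ω v => X v ω) ⁻¹' R := rfl
  rw [hrR]
  -- The identity `q * p = pE` can fail only where `p = ∞`; where `p = 0`, also `pE = 0`. Cutting
  -- out `p = ∞` changes no integral against `f`, which vanishes there almost everywhere.
  set N := Set.indicator ({x | p x = ∞}ᶜ ∩ R) (1 : (∀ v, 𝓧 v) → ℝ≥0∞)
  have hNm : Measurable N :=
    measurable_one.indicator ((hp (measurableSet_singleton _)).compl.inter hR)
  have hRC := dependsOn_indicator_subvector r'
  have hNC : DependsOn N C := by
    have h1 : N = Set.indicator {x | p x = ∞}ᶜ 1 * R.indicator 1 := by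
      rw [← Set.inter_indicator_one]
    rw [h1]
    refine DependsOn.mul_fun (fun x y h => ?_) hRC
    simp only [Set.indicator, Set.mem_compl_iff, Set.mem_ofPred_eq, hpC h, Pi.one_apply]
  have hNR : ∀ g : (∀ v, 𝓧 v) → ℝ≥0∞, ∫⁻ x, (R.indicator (1 : (∀ v, 𝓧 v) → ℝ≥0∞) * g * f) x ∂(Measure.pi μ) =
      ∫⁻ x, (N * g * f) x ∂(Measure.pi μ) := fun g => by
    refine lintegral_congr_ae ?_
    filter_upwards [ae_lmarginal_eq_top_imp hs hf hfin] with x hx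
    by_cases hpx : p x = ∞
    · simp [hx hpx]
    · have hmem : x ∈ {x | p x = ∞}ᶜ ∩ R ↔ x ∈ R := and_iff_right hpx
      simp only [Pi.mul_apply, N]
      congr 2
      by_cases hxR : x ∈ R
      · rw [Set.indicator_of_mem hxR, Set.indicator_of_mem (hmem.2 hxR)]
      · rw [Set.indicator_of_notMem hxR, Set.indicator_of_notMem (mt hmem.1 hxR)]
  have key : ∫⁻ x, (N * q * f) x ∂(Measure.pi μ) =
      ∫⁻ x, (N * E.indicator (1 : (∀ v, 𝓧 v) → ℝ≥0∞) * f) x ∂(Measure.pi μ) := by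
    refine lintegral_eq_of_lmarginal_eq s ((hNm.mul hq).mul hf) ((hNm.mul hEm).mul hf) ?_
    rw [lmarginal_mul_left (by rw [hsC]; exact hNC.mul_fun hqC) hf,
      mul_assoc N (E.indicator 1) f,
      lmarginal_mul_left (by rw [hsC]; exact hNC) (hEm.mul hf), ← hp_def, ← hpE_def]
    ext x
    simp only [Pi.mul_apply, q, mul_assoc]
    by_cases hpx : p x = ∞
    · simp [N, hpx]
    congr 1
    by_cases hp0 : p x = 0
    · have : pE x = 0 := le_antisymm ((hle x).trans hp0.le) zero_le
      simp [this]
    · exact ENNReal.div_mul_cancel hp0 hpx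
  have hX_R : MeasurableSet ((fun ω v => X v ω) ⁻¹' R) := hXm hR
  have lhs : ∫⁻ ω in (fun ω v => X v ω) ⁻¹' R, q (fun v => X v ω) ∂P =
      ∫⁻ x, (R.indicator (1 : (∀ v, 𝓧 v) → ℝ≥0∞) * q * f) x ∂(Measure.pi μ) := by
    rw [← hint _ ((measurable_one.indicator hR).mul hq), ← lintegral_indicator hX_R]
    refine lintegral_congr fun ω => ?_
    by_cases h : (fun v => X v ω) ∈ R <;> simp [Set.indicator, h]
  have rhs : P ((fun ω v => X v ω) ⁻¹' E ∩ (fun ω v => X v ω) ⁻¹' R) =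
      ∫⁻ x, (R.indicator (1 : (∀ v, 𝓧 v) → ℝ≥0∞) * E.indicator (1 : (∀ v, 𝓧 v) → ℝ≥0∞) * f) x ∂(Measure.pi μ) := by
    rw [← hint _ ((measurable_one.indicator hR).mul hEm),
      ← lintegral_indicator_one ((hXm hE).inter hX_R)]
    refine lintegral_congr fun ω => ?_
    by_cases h : (fun v => X v ω) ∈ R <;> by_cases h' : (fun v => X v ω) ∈ E <;>
      simp [Set.indicator, h, h']
  rw [setIntegral_indicator (hXm hE), integral_toReal (f := fun ω => q fun v => X v ω) (hq.comp hXm).aemeasurable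
    (Filter.Eventually.of_forall fun ω => (hq1 _).trans_lt ENNReal.one_lt_top)]
  simp only [integral_const, MeasurableSet.univ, measureReal_restrict_apply, Set.univ_inter,
    smul_eq_mul, mul_one]
  rw [lhs, hNR, key, ← hNR, ← rhs, Set.inter_comm]
  rfl

/-- If the marginal densities factorize, then `X_A` and `X_B` are conditionally independent given
`X_C`. -/
theorem condIndepFun_subvector_of_lmarginal_mul_eq [StandardBorelSpace Ω]
    (hX : ∀ v, Measurable (X v)) (hf : Measurable f)
    (hlaw : P.map (fun ω v => X v ω) = (Measure.pi μ).withDensity f)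
    (hs : ∀ v, v ∈ s ↔ v ∉ C) {A B : Set V}
    (hfac : ∀ φ ψ : (∀ v, 𝓧 v) → ℝ≥0∞, Measurable φ → Measurable ψ → DependsOn φ A →
      DependsOn ψ B → lmarginal μ s (φ * ψ * f) * lmarginal μ s f =
        lmarginal μ s (φ * f) * lmarginal μ s (ψ * f)) :
    CondIndepFun (MeasurableSpace.comap (subvector X C) inferInstance)
      (measurable_subvector hX C).comap_le (subvector X A) (subvector X B) P := by
  rw [condIndepFun_iff_condExp_inter_preimage_eq_mul (measurable_subvector hX A)
    (measurable_subvector hX B)]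
  intro a b ha hb
  have hXm : Measurable fun ω v => X v ω := measurable_pi_lambda _ hX
  have hfin : ∫⁻ x, f x ∂(Measure.pi μ) ≠ ∞ := by
    rw [← setLIntegral_univ, ← withDensity_apply _ MeasurableSet.univ, ← hlaw]
    have := Measure.isProbabilityMeasure_map (μ := P) hXm.aemeasurable
    exact measure_ne_top _ _
  have hp : Measurable (lmarginal μ s f) := hf.lmarginal μ
  have hne : ∀ᵐ ω ∂P, lmarginal μ s f (fun v => X v ω) ≠ ∞ := by
    refine ae_of_ae_map (p := fun x => lmarginal μ s f x ≠ ∞) hXm.aemeasurable ?_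
    rw [hlaw, ae_withDensity_iff hf]
    filter_upwards [ae_lmarginal_eq_top_imp hs hf hfin] with x hx hfx hpx
    exact hfx (hx hpx)
  have hA := measurableSet_preimage_subvector ha
  have hB := measurableSet_preimage_subvector hb
  have h := hfac _ _ (measurable_one.indicator hA) (measurable_one.indicator hB)
    (dependsOn_indicator_subvector a) (dependsOn_indicator_subvector b)
  rw [← Set.inter_indicator_one] at h
  filter_upwards [hne, condExp_indicator_ae_eq_lmarginal_div hX hf hlaw hs (hA.inter hB),
    condExp_indicator_ae_eq_lmarginal_div hX hf hlaw hs hA,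
    condExp_indicator_ae_eq_lmarginal_div hX hf hlaw hs hB] with ω hω e1 e2 e3
  refine e1.trans ?_
  refine Eq.trans ?_ (congrArg₂ (· * ·) e2 e3).symm
  have hx := congrFun h fun v => X v ω
  simp only [Pi.mul_apply] at hx
  rw [← ENNReal.toReal_mul]
  congr 1
  by_cases hp0 : lmarginal μ s f (fun v => X v ω) = 0
  · have hzero : ∀ E : Set (∀ v, 𝓧 v),
        lmarginal μ s (E.indicator 1 * f) (fun v => X v ω) = 0 := fun E => by
      refine le_antisymm (le_trans ?_ hp0.le) zero_le
      refine lmarginal_mono (fun x => ?_) _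
      by_cases hx : x ∈ E <;> simp [hx]
    simp only [hzero, ENNReal.zero_div, mul_zero]
  · rw [← ENNReal.mul_div_mul_right _ _ hp0 hω, hx, ENNReal.div_eq_inv_mul, ENNReal.div_eq_inv_mul,
      ENNReal.div_eq_inv_mul, ENNReal.mul_inv (Or.inl hp0) (Or.inl hω)]
    ring

end ConditionalDensity

/-! ### Passage to the mother graph and the global Markov property. -/

theorem MixtureOfDAGs.motherGraph_adj {V : Type*} [Fintype V] [DecidableEq V] {𝓧 : V → Type*}
    [∀ v, MeasurableSpace (𝓧 v)] {μ : ∀ v, Measure (𝓧 v)} {𝒯 : Type*} [MeasurableSpace 𝒯]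
    {ν : Measure 𝒯} (D : MixtureOfDAGs V 𝓧 μ 𝒯 ν) {t : 𝒯} (ht : D.timeDensity t ≠ 0)
    (x y : Option V) :
    (motherGraph D.subDAGs).Adj (⟨D.dag t, t, ht, rfl⟩, x) (⟨D.dag t, t, ht, rfl⟩, y) ↔
      (D.dag t).Adj x y :=
  and_iff_right rfl

/-- `T` has the same children in all sub-DAGs. -/
theorem MixtureOfDAGs.reachesByTail_none_congr {V : Type*} [Fintype V] [DecidableEq V]
    {𝓧 : V → Type*} [∀ v, MeasurableSpace (𝓧 v)] {μ : ∀ v, Measure (𝓧 v)} {𝒯 : Type*}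
    [MeasurableSpace 𝒯] {ν : Measure 𝒯} (D : MixtureOfDAGs V 𝓧 μ 𝒯 ν) {i : D.subDAGs}
    {E F : Set (Option V)} (h : ReachesByTail (motherGraph D.subDAGs) i E F none) {t : 𝒯}
    (ht : D.timeDensity t ≠ 0) :
    ReachesByTail (motherGraph D.subDAGs) ⟨D.dag t, t, ht, rfl⟩ E F none := by
  obtain ⟨_, s, hs, rfl⟩ := i
  rcases h with h | ⟨y, hy, h⟩
  · exact Or.inl h
  refine Or.inr ⟨y, ?_, h⟩
  rw [D.motherGraph_adj hs] at hy
  rw [D.motherGraph_adj ht]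
  cases y with
  | none => exact absurd hy (D.time_root s hs none)
  | some v => rwa [D.time_parent t ht, ← D.time_parent s hs]

theorem theorem1 {V : Type*} [Fintype V] [DecidableEq V] {𝓧 : V → Type*}
    [∀ v, MeasurableSpace (𝓧 v)] (μ : ∀ v, Measure (𝓧 v)) [∀ v, SigmaFinite (μ v)]
    {𝒯 : Type*} [MeasurableSpace 𝒯] (ν : Measure 𝒯) [SigmaFinite ν]
    (D : MixtureOfDAGs V 𝓧 μ 𝒯 ν)
    {Ω : Type*} [MeasurableSpace Ω] [StandardBorelSpace Ω]
    (P : Measure Ω) [IsProbabilityMeasure P]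
    (X : ∀ v, Ω → 𝓧 v) (hX : ∀ v, Measurable (X v))
    (hdensity : P.map (fun ω v => X v ω) = (Measure.pi μ).withDensity D.density)
    (A B C : Set V) (hAB : Disjoint A B) (hAC : Disjoint A C) (hBC : Disjoint B C)
    (hsep : MDSeparated (motherGraph D.subDAGs) (some '' A) (some '' B) (some '' C)) :
    CondIndepFun (MeasurableSpace.comap (subvector X C) inferInstance)
      (measurable_subvector hX C).comap_le (subvector X A) (subvector X B) P := by
  classical
  have hxAdj : ∀ t (ht : D.timeDensity t ≠ 0),
      xAdj (motherGraph D.subDAGs) ⟨D.dag t, t, ht, rfl⟩ = D.xEdge t := fun t ht => by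
    funext u v
    exact propext (D.motherGraph_adj ht _ _)
  have hs : ∀ v, v ∈ Finset.univ.filter (· ∉ C) ↔ v ∉ C := by simp
  have hAQ : A ⊆ A ∪ B ∪ C := fun v hv => Or.inl (Or.inl hv)
  have hBQ : B ⊆ A ∪ B ∪ C := fun v hv => Or.inl (Or.inr hv)
  have hCQ : C ⊆ A ∪ B ∪ C := Set.subset_union_right
  -- The split decides which factor is free of `t`. If `T` reaches `B`, it is the one carrying `A`,
  -- so `A` and `B` trade places and conditional independence is used in its symmetric form.
  by_cases hT : ∃ i, ReachesByTail (motherGraph D.subDAGs) i (some '' B) (some '' C) none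
  · obtain ⟨i, hi⟩ := hT
    refine (condIndepFun_subvector_of_lmarginal_mul_eq hX D.measurable_density hdensity hs
      fun φ ψ hφ hψ hφB hψA => ?_).symm
    refine MixtureOfDAGs.lmarginal_density_mul_eq hAC hCQ ?_ hBQ hAQ ?_ hφ hψ hφB hψA
    · intro t ht w hw hadj
      rw [← hxAdj t ht] at hw
      exact not_reachesByTail_none_of_componentFamilies hAB hAC hsep hw
        ((D.motherGraph_adj ht _ _).2 hadj) (D.reachesByTail_none_congr hi ht)
    · intro t ht
      rw [← hxAdj t ht]
      exact disjoint_moralComponent_of_mdSeparated' hAB hsep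
  · push Not at hT
    refine condIndepFun_subvector_of_lmarginal_mul_eq hX D.measurable_density hdensity hs
      fun φ ψ hφ hψ hφA hψB => ?_
    refine MixtureOfDAGs.lmarginal_density_mul_eq hBC hCQ ?_ hAQ hBQ ?_ hφ hψ hφA hψB
    · intro t ht w hw hadj
      rw [← hxAdj t ht] at hw
      exact hT _ (reachesByTail_none_of_componentFamilies hBC hsep hw
        ((D.motherGraph_adj ht _ _).2 hadj))
    · intro t ht
      rw [← hxAdj t ht]
      exact disjoint_moralComponent_of_mdSeparated hAB hsep
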